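/- Let $n \ge 0$. Put $\Delta_n = \{(i,j)\in\mathbb{Z}_{\ge 0}^2 : i+j\le n\}$, and let $\Delta_n^+$ and $\Delta_n^-$ be the subsets of $\Delta_n$ where $i+j\equiv n$, respectively $i+j\equiv n-1$, modulo $2$. A *skep* is a function $g:\Delta_n\to\mathbb{Z}$ such that, for all $(i,j)$ for which the indices that occur lie in $\Delta_n$, $$g_{ij}-g_{(i+1)(j+1)}\le g_{(i+1)j}-g_{(i+2)(j+1)},\qquad g_{ij}-g_{(i+1)(j+1)}\le g_{i(j+1)}-g_{(i+1)(j+2)},$$ $$g_{ij}-g_{(i+1)(j-1)}\le g_{i(j-1)}-g_{(i+1)(j-2)},\qquad g_{ij}-g_{(i+1)(j-1)}\le g_{(i+1)j}-g_{(i+2)(j-1)},$$ and $0\le g_{00}-g_{11}$ (if $n\ge 2$). For $g:\Delta_n\to\mathbb{Z}$ let $(z_1,\dots,z_{2n})$ be the successive differences of $g$ along the path $(n,0),(n-1,0),\dots,(0,0),(0,1),\dots,(0,n)$, and put $\partial_1(g)=(z_1,z_3,\dots,z_{2n-1})$. The *outer boundary* of $g^+:\Delta_n^+\to\mathbb{Z}$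 is $\partial^+(g^+)=(z_1+z_2,z_3+z_4,\dots,z_{2n-1}+z_{2n})$, that is, the sequence of successive differences of $g^+$ along every second point of this path, starting at $(n,0)$. For $g^\pm:\Delta_n^\pm\to\mathbb{Z}$ let $(g^+,g^-):\Delta_n\to\mathbb{Z}$ be the function that restricts to $g^+$ and $g^-$. For $g^+ : \Delta_n^+ \to \mathbb{Z}$ and $\lambda\in\mathbb{Z}^n$ let $E(g^+,\lambda)$ be the set of all $g^-:\Delta_n^-\to\mathbb{Z}$ such that $(g^+,g^-)$ is a skep with $\partial_1(g^+,g^-)=\lambda$, and let $\mathrm{SkepExt}(g^+,\lambda)=\# E(g^+,\lambda)$. Let $T_n=\{(i,j,t)\in\mathbb{Z}^3 : i,j\ge 0,\ |t|\le n-i-j,\ t\equiv i+j+n \bmod 2\}$. A function $h:T_n\to\mathbb{Z}$ *obeys the octahedron recurrence* if, whenever $(i,j,t)$ and $(i,j,t-2)$ lie in $T_n$, the sum $h(i,j,t)+h(i,j,t-2)$ equals $$\begin{cases}\max\bigl(h(i-1,j,t-1)+h(i+1,j,t-1),\ h(i,j-1,t-1)+h(i,j+1,t-1)\bigr) & i,j\ge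 1,\\ h(i-1,0,t-1)+h(i+1,0,t-1) & i\ge 1,\ j=0,\\ h(0,j-1,t-1)+h(0,j+1,t-1) & i=0,\ j\ge 1,\\ h(1,0,t-1)+h(0,1,t-1) & i=j=0.\end{cases}$$ Let $\epsilon(i,j)$ be $0$ on $\Delta_n^+$ and $1$ on $\Delta_n^-$. The restrictions of $h$ to the top and bottom skep slices are the functions $(i,j)\mapsto h(i,j,\epsilon(i,j))$ and $(i,j)\mapsto h(i,j,-\epsilon(i,j))$ on $\Delta_n$. **Theorem.** Let $\lambda,\mu\in\mathbb{Z}^n$ be partitions ($\lambda_1\ge\dots\ge\lambda_n\ge 0$, and likewise $\mu$), and let $g^+:\Delta_n^+\to\mathbb{Z}$ satisfy $\partial^+(g^+)=\lambda+\mu$. Then $E(g^+,\lambda)$ and $E(g^+,\mu)$ are finite and $$\mathrm{SkepExt}(g^+,\lambda)=\mathrm{SkepExt}(g^+,\mu).$$ Moreover, there is a bijection $\Phi:E(g^+,\lambda)\to E(g^+,\mu)$ given by the octahedron recurrence: for each $g^-\in E(g^+,\lambda)$ there is exactly one $h:T_n\to\mathbb{Z}$ that obeys the octahedron recurrence and restricts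 to $(g^+,g^-)$ on the bottom skep slice, and this $h$ restricts to $(g^+,\Phi(g^-))$ on the top skep slice. -/

import Mathlib

namespace Skep

/-- `λ ∈ ℤⁿ` is a partition if `λ₁ ≥ λ₂ ≥ ⋯ ≥ λₙ ≥ 0`. -/
def IsPartition {n : ℕ} (lam : Fin n → ℤ) : Prop :=
  Antitone lam ∧ ∀ k, 0 ≤ lam k

/-! ### The triangle, its two halves, and skeps -/

/-- The triangle `Δ_n` of pairs `(i, j)` of natural numbers with `i + j ≤ n`. -/
abbrev Delta (n : ℕ) : Type := {p : ℕ × ℕ // p.1 + p.2 ≤ n}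

/-- `Δ_n⁺`: the points of `Δ_n` with `i + j ≡ n` modulo 2. -/
abbrev DeltaPlus (n : ℕ) : Type := {p : ℕ × ℕ // p.1 + p.2 ≤ n ∧ (p.1 + p.2) % 2 = n % 2}

/-- `Δ_n⁻`: the points of `Δ_n` with `i + j ≡ n - 1` modulo 2. -/
abbrev DeltaMinus (n : ℕ) : Type := {p : ℕ × ℕ // p.1 + p.2 ≤ n ∧ (p.1 + p.2 + 1) % 2 = n % 2}

/-- The point `(i, j)` of `Δ_n`. -/
def pt {n : ℕ} (i j : ℕ) (h : i + j ≤ n) : Delta n := ⟨(i, j), h⟩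

/-- A skep: an integer function on `Δ_n` obeying the following inequalities whenever all indices
remain within `Δ_n`. In the third and fourth inequality the index `j` is shifted (by 2 and 1
respectively) so that no subtraction of indices is needed. -/
structure IsSkep {n : ℕ} (g : Delta n → ℤ) : Prop where
  ne_right : ∀ (i j : ℕ) (h : i + j + 3 ≤ n),
    g (pt i j (by omega)) - g (pt (i + 1) (j + 1) (by omega))
      ≤ g (pt (i + 1) j (by omega)) - g (pt (i + 2) (j + 1) (by omega))
  ne_up : ∀ (i j : ℕ) (h : i + j + 3 ≤ n),
    g (pt i j (by omega)) - g (pt (i + 1) (j + 1) (by omega))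
      ≤ g (pt i (j + 1) (by omega)) - g (pt (i + 1) (j + 2) (by omega))
  nw_down : ∀ (i j : ℕ) (h : i + j + 2 ≤ n),
    g (pt i (j + 2) (by omega)) - g (pt (i + 1) (j + 1) (by omega))
      ≤ g (pt i (j + 1) (by omega)) - g (pt (i + 1) j (by omega))
  nw_right : ∀ (i j : ℕ) (h : i + j + 2 ≤ n),
    g (pt i (j + 1) (by omega)) - g (pt (i + 1) j (by omega))
      ≤ g (pt (i + 1) (j + 1) (by omega)) - g (pt (i + 2) j (by omega))
  corner : ∀ h : 2 ≤ n, 0 ≤ g (pt 0 0 (by omega)) - g (pt 1 1 (by omega))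

/-- The function `(g⁺, g⁻)` on `Δ_n` with restrictions `g⁺` to `Δ_n⁺` and `g⁻` to `Δ_n⁻`. -/
def interweave {n : ℕ} (gp : DeltaPlus n → ℤ) (gm : DeltaMinus n → ℤ) : Delta n → ℤ :=
  fun p =>
    if h : (p.1.1 + p.1.2) % 2 = n % 2 then gp ⟨p.1, p.2, h⟩
    else gm ⟨p.1, p.2, by omega⟩

/-! ### Boundaries -/

/-- The `k`-th point, `0 ≤ k ≤ 2n`, of the path `(n,0), (n-1,0), …, (0,0), (0,1), …, (0,n)`.
The subtractions are truncated: exactly one of the coordinates is zero, unless `k = n`. -/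
def cornerPath {n : ℕ} (k : ℕ) (hk : k ≤ 2 * n) : Delta n := pt (n - k) (k - n) (by omega)

/-- The corner boundary `(z₁, …, z₂ₙ)`: the successive differences along the corner path
(the entry `zₖ₊₁` has index `k`). -/
def cornerBoundary {n : ℕ} (g : Delta n → ℤ) (k : Fin (2 * n)) : ℤ :=
  g (cornerPath (k + 1) (by omega)) - g (cornerPath k (by omega))

/-- `∂₁(g) = (z₁, z₃, …, z₂ₙ₋₁)`. -/
def boundaryOne {n : ℕ} (g : Delta n → ℤ) (k : Fin n) : ℤ :=
  cornerBoundary g ⟨2 * k, by omega⟩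

/-- `∂₂(g) = (z₂, z₄, …, z₂ₙ)`. -/
def boundaryTwo {n : ℕ} (g : Delta n → ℤ) (k : Fin n) : ℤ :=
  cornerBoundary g ⟨2 * k + 1, by omega⟩

/-- Every second point of the corner path lies in `Δ_n⁺`. -/
def outerPath {n : ℕ} (k : ℕ) (hk : k ≤ n) : DeltaPlus n :=
  ⟨(n - 2 * k, 2 * k - n), by simp only; omega⟩

/-- The outer boundary `∂⁺(g⁺) = (z₁ + z₂, z₃ + z₄, …, z₂ₙ₋₁ + z₂ₙ)`, which is the sequence of
successive differences of `g⁺` along `(n,0), (n-2,0), …, (0,n-2), (0,n)`. -/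
def outerBoundary {n : ℕ} (gp : DeltaPlus n → ℤ) (k : Fin n) : ℤ :=
  gp (outerPath (k + 1) (by omega)) - gp (outerPath k (by omega))

/-- The outer boundary of `g⁺` is `∂₁ + ∂₂` of any function on `Δ_n` extending `g⁺`. -/
theorem outerBoundary_eq {n : ℕ} (gp : DeltaPlus n → ℤ) (gm : DeltaMinus n → ℤ) :
    outerBoundary gp = boundaryOne (interweave gp gm) + boundaryTwo (interweave gp gm) := by
  have key : ∀ (k : ℕ) (hk : k ≤ n),
      interweave gp gm (cornerPath (2 * k) (by omega)) = gp (outerPath k hk) := by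
    intro k hk
    have h : (n - 2 * k + (2 * k - n)) % 2 = n % 2 := by omega
    unfold interweave
    exact dif_pos h
  funext k
  have h1 := key k (by omega)
  have h2 := key (k + 1) (by omega)
  simp only [Pi.add_apply, outerBoundary, boundaryOne, boundaryTwo, cornerBoundary, ← h1, ← h2]
  have e : 2 * ((k : ℕ) + 1) = 2 * k + 1 + 1 := by ring
  simp only [e]
  ring

/-- The functions `g⁻` on `Δ_n⁻` such that `(g⁺, g⁻)` is a skep with `∂₁(g⁺, g⁻) = λ`. -/
def skepExtensions {n : ℕ} (gp : DeltaPlus n → ℤ) (lam : Fin n → ℤ) : Set (DeltaMinus n → ℤ) :=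
  {gm | IsSkep (interweave gp gm) ∧ boundaryOne (interweave gp gm) = lam}

/-- `SkepExt(g⁺, λ)`: the number of `g⁻` such that `(g⁺, g⁻)` is a skep with
`∂₁(g⁺, g⁻) = λ`. -/
noncomputable def SkepExt {n : ℕ} (gp : DeltaPlus n → ℤ) (lam : Fin n → ℤ) : ℕ :=
  (skepExtensions gp lam).ncard

/-! ### The octahedron recurrence -/

/-- `(i, j, t)` lies in `T_n`: `|t| ≤ n - i - j` and `t ≡ i + j + n` modulo 2. -/
def InT (n i j : ℕ) (t : ℤ) : Prop :=
  |t| ≤ (n : ℤ) - i - j ∧ t ≡ i + j + n [ZMOD 2]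

/-- The intersection `T_n` of a tetrahedron with a face centered cubic lattice. -/
abbrev T (n : ℕ) : Type := {p : ℕ × ℕ × ℤ // InT n p.1 p.2.1 p.2.2}

/-- The point `(i, j, t)` of `T_n`. -/
def tpt {n : ℕ} (i j : ℕ) (t : ℤ) (h : InT n i j t) : T n := ⟨(i, j, t), h⟩

theorem InT.right {n i j : ℕ} {t : ℤ} (h : InT n i j t) (h' : InT n i j (t - 2)) :
    InT n (i + 1) j (t - 1) := by
  simp only [InT, abs_le, Int.ModEq] at *; omega

theorem InT.up {n i j : ℕ} {t : ℤ} (h : InT n i j t) (h' : InT n i j (t - 2)) :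
    InT n i (j + 1) (t - 1) := by
  simp only [InT, abs_le, Int.ModEq] at *; omega

theorem InT.left {n i j : ℕ} {t : ℤ} (h : InT n (i + 1) j t) (h' : InT n (i + 1) j (t - 2)) :
    InT n i j (t - 1) := by
  simp only [InT, abs_le, Int.ModEq] at *; omega

theorem InT.down {n i j : ℕ} {t : ℤ} (h : InT n i (j + 1) t) (h' : InT n i (j + 1) (t - 2)) :
    InT n i j (t - 1) := by
  simp only [InT, abs_le, Int.ModEq] at *; omega

/-- The octahedron recurrence, for all pairs `(i, j, t)`, `(i, j, t - 2)` of points of `T_n`.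
The four clauses are for `i, j ≥ 1`, for `i ≥ 1` and `j = 0`, for `i = 0` and `j ≥ 1`, and for
`i = j = 0`; a coordinate that is at least 1 is written as a successor. -/
structure ObeysOctahedron {n : ℕ} (h : T n → ℤ) : Prop where
  interior : ∀ (i j : ℕ) (t : ℤ) (a : InT n (i + 1) (j + 1) t) (b : InT n (i + 1) (j + 1) (t - 2)),
    h (tpt (i + 1) (j + 1) t a) + h (tpt (i + 1) (j + 1) (t - 2) b) =
      max (h (tpt i (j + 1) (t - 1) (a.left b)) + h (tpt (i + 2) (j + 1) (t - 1) (a.right b)))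
        (h (tpt (i + 1) j (t - 1) (a.down b)) + h (tpt (i + 1) (j + 2) (t - 1) (a.up b)))
  bottom_edge : ∀ (i : ℕ) (t : ℤ) (a : InT n (i + 1) 0 t) (b : InT n (i + 1) 0 (t - 2)),
    h (tpt (i + 1) 0 t a) + h (tpt (i + 1) 0 (t - 2) b) =
      h (tpt i 0 (t - 1) (a.left b)) + h (tpt (i + 2) 0 (t - 1) (a.right b))
  left_edge : ∀ (j : ℕ) (t : ℤ) (a : InT n 0 (j + 1) t) (b : InT n 0 (j + 1) (t - 2)),
    h (tpt 0 (j + 1) t a) + h (tpt 0 (j + 1) (t - 2) b) =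
      h (tpt 0 j (t - 1) (a.down b)) + h (tpt 0 (j + 2) (t - 1) (a.up b))
  origin : ∀ (t : ℤ) (a : InT n 0 0 t) (b : InT n 0 0 (t - 2)),
    h (tpt 0 0 t a) + h (tpt 0 0 (t - 2) b) =
      h (tpt 1 0 (t - 1) (a.right b)) + h (tpt 0 1 (t - 1) (a.up b))

/-- `ε(i, j)` is `0` on `Δ_n⁺` and `1` on `Δ_n⁻`. -/
def eps (n i j : ℕ) : ℤ := if (i + j) % 2 = n % 2 then 0 else 1

theorem inT_eps {n i j : ℕ} (h : i + j ≤ n) : InT n i j (eps n i j) := by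
  simp only [InT, abs_le, Int.ModEq, eps]; split_ifs <;> omega

theorem inT_neg_eps {n i j : ℕ} (h : i + j ≤ n) : InT n i j (-eps n i j) := by
  simp only [InT, abs_le, Int.ModEq, eps]; split_ifs <;> omega

/-- The restriction of a function on `T_n` to the top skep slice `{(i, j, ε(i, j))}`, viewed as a
function on `Δ_n`. -/
def skepTop {n : ℕ} (h : T n → ℤ) : Delta n → ℤ :=
  fun p => h (tpt p.1.1 p.1.2 (eps n p.1.1 p.1.2) (inT_eps p.2))

/-- The restriction of a function on `T_n` to the bottom skep slice `{(i, j, -ε(i, j))}`, viewed as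
a function on `Δ_n`. -/
def skepBottom {n : ℕ} (h : T n → ℤ) : Delta n → ℤ :=
  fun p => h (tpt p.1.1 p.1.2 (-eps n p.1.1 p.1.2) (inT_neg_eps p.2))

end Skep

namespace Skep

/-! ### Functions on the whole quadrant -/

/-! The two skep slices agree on `Δ_n⁺`, and over each point of `Δ_n⁻` they are one octahedron
apart. So `Φ` must be `reflect`: it replaces each value `x` of `g⁻` by `s - x`, where `s` (`octSum`)
depends on `g⁺` alone. Hence `Φ` is an involution. It preserves skeps (`SkepIneq.flip`) by a local
check. On the corner path `s` is the sum of the two adjacent values, so `Φ` exchanges `∂₁` and `∂₂`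
(`boundaryOne_reflect`). As `∂₁ + ∂₂ = λ + μ`, it exchanges the extension sets for `λ` and `μ`.
Finiteness: `∂₁` fixes `g⁻` on an axis, and the skep inequalities bound its steps along
antidiagonals. The bottom slice determines a unique `h`, since the recurrence can be run from it in
both time directions. -/

/-- The right-hand side of the octahedron recurrence, for a function on the quadrant. -/
def octSum (f : ℕ → ℕ → ℤ) : ℕ → ℕ → ℤ
  | 0, 0 => f 1 0 + f 0 1
  | i + 1, 0 => f i 0 + f (i + 2) 0
  | 0, j + 1 => f 0 j + f 0 (j + 2)
  | i + 1, j + 1 => max (f i (j + 1) + f (i + 2) (j + 1)) (f (i + 1) j + f (i + 1) (j + 2))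

/-- `octSum f i j` depends only on the values of `f` at the neighbours of `(i, j)`. -/
theorem octSum_congr {f g : ℕ → ℕ → ℤ} {i j : ℕ}
    (h : ∀ i' j', i' + j' = i + j + 1 ∨ i' + j' + 1 = i + j → f i' j' = g i' j') :
    octSum f i j = octSum g i j := by
  rcases i with _ | i <;> rcases j with _ | j <;> simp only [octSum]
  · rw [h 1 0 (by omega), h 0 1 (by omega)]
  · rw [h 0 j (by omega), h 0 (j + 2) (by omega)]
  · rw [h i 0 (by omega), h (i + 2) 0 (by omega)]
  · rw [h i (j + 1) (by omega), h (i + 2) (j + 1) (by omega), h (i + 1) j (by omega),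
      h (i + 1) (j + 2) (by omega)]

/-- The skep inequalities inside `Δ_n`, for a function on the quadrant. -/
structure SkepIneq (n : ℕ) (G : ℕ → ℕ → ℤ) : Prop where
  ne_right : ∀ i j, i + j + 3 ≤ n → G i j + G (i + 2) (j + 1) ≤ G (i + 1) j + G (i + 1) (j + 1)
  ne_up : ∀ i j, i + j + 3 ≤ n → G i j + G (i + 1) (j + 2) ≤ G i (j + 1) + G (i + 1) (j + 1)
  nw_down : ∀ i j, i + j + 2 ≤ n → G i (j + 2) + G (i + 1) j ≤ G i (j + 1) + G (i + 1) (j + 1)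
  nw_right : ∀ i j, i + j + 2 ≤ n → G i (j + 1) + G (i + 2) j ≤ G (i + 1) (j + 1) + G (i + 1) j
  corner : 2 ≤ n → G 1 1 ≤ G 0 0

/-- One layer of the octahedron recurrence: the values on `Δ_n⁻` are replaced. -/
def flip (n : ℕ) (G : ℕ → ℕ → ℤ) (i j : ℕ) : ℤ :=
  if (i + j) % 2 = n % 2 then G i j else octSum G i j - G i j

theorem flip_of_even {n : ℕ} (G : ℕ → ℕ → ℤ) {i j : ℕ} (h : (i + j) % 2 = n % 2) :
    flip n G i j = G i j := if_pos h

theorem flip_of_odd {n : ℕ} (G : ℕ → ℕ → ℤ) {i j : ℕ} (h : ¬ (i + j) % 2 = n % 2) :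
    flip n G i j = octSum G i j - G i j := if_neg h

/-! ### Preservation of the skep inequalities -/

/-- The transpose of a function satisfying the skep inequalities satisfies them. -/
theorem SkepIneq.swap {n : ℕ} {G : ℕ → ℕ → ℤ} (hG : SkepIneq n G) :
    SkepIneq n (fun i j => G j i) where
  ne_right i j h := hG.ne_up j i (by omega)
  ne_up i j h := hG.ne_right j i (by omega)
  nw_down i j h := by have := hG.nw_right j i (by omega); omega
  nw_right i j h := by have := hG.nw_down j i (by omega); omega
  corner h := hG.corner h

theorem octSum_swap (G : ℕ → ℕ → ℤ) (i j : ℕ) :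
    octSum (fun i j => G j i) i j = octSum G j i := by
  rcases i with _ | i <;> rcases j with _ | j <;> simp only [octSum]
  · exact add_comm _ _
  · exact max_comm _ _

theorem flip_swap (n : ℕ) (G : ℕ → ℕ → ℤ) (i j : ℕ) :
    flip n (fun i j => G j i) i j = flip n G j i := by
  simp only [flip, octSum_swap, add_comm i j]

/-- Bound the `octSum` on the right below by one of its alternatives; each alternative of the
`octSum` on the left then leaves a single skep inequality for `G`. At the origin that inequality is
`corner`. -/
theorem SkepIneq.flip_ne_right {n : ℕ} {G : ℕ → ℕ → ℤ} (hG : SkepIneq n G) (i j : ℕ)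
    (h : i + j + 3 ≤ n) :
    flip n G i j + flip n G (i + 2) (j + 1) ≤
      flip n G (i + 1) j + flip n G (i + 1) (j + 1) := by
  by_cases p : (i + j) % 2 = n % 2
  · rw [flip_of_even G p, flip_of_odd G (by omega), flip_of_odd G (by omega),
      flip_of_even G (by omega)]
    -- Parity improves `i + j + 3 ≤ n` to `i + j + 4 ≤ n`, which makes room for the shifted
    -- inequalities.
    have h1 := hG.ne_right (i + 1) j (by omega)
    have h2 := hG.ne_up (i + 1) j (by omega)
    rcases j with _ | j <;> simp only [octSum, Nat.add_assoc, Nat.reduceAdd, Nat.zero_add] at * <;> omega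
  · rw [flip_of_odd G p, flip_of_even G (by omega), flip_of_even G (by omega),
      flip_of_odd G (by omega)]
    rcases i with _ | i <;> rcases j with _ | j
    · have h1 := hG.corner (by omega)
      simp only [octSum, Nat.zero_add] at *; omega
    · have h2 := hG.ne_up 0 j (by omega)
      simp only [octSum, Nat.add_assoc, Nat.reduceAdd, Nat.zero_add] at *; omega
    · have h1 := hG.ne_right i 0 (by omega)
      simp only [octSum, Nat.add_assoc, Nat.reduceAdd, Nat.zero_add] at *; omega
    · have h1 := hG.ne_right i (j + 1) (by omega)
      have h2 := hG.ne_up (i + 1) j (by omega)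
      simp only [octSum, Nat.add_assoc, Nat.reduceAdd] at *; omega

/-- The same mechanism as for `flip_ne_right`; on the axes `octSum` has a single alternative, so
fewer inequalities are needed. -/
theorem SkepIneq.flip_nw_down {n : ℕ} {G : ℕ → ℕ → ℤ} (hG : SkepIneq n G) (i j : ℕ)
    (h : i + j + 2 ≤ n) :
    flip n G i (j + 2) + flip n G (i + 1) j ≤
      flip n G i (j + 1) + flip n G (i + 1) (j + 1) := by
  by_cases p : (i + j) % 2 = n % 2
  · rw [flip_of_even G (by omega), flip_of_odd G (by omega), flip_of_odd G (by omega),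
      flip_of_even G (by omega)]
    have h1 := hG.nw_right i j (by omega)
    rcases i with _ | i <;> rcases j with _ | j
    · simp only [octSum, Nat.zero_add] at *; omega
    · have h2 := hG.nw_down 0 j (by omega)
      simp only [octSum, Nat.add_assoc, Nat.reduceAdd, Nat.zero_add] at *; omega
    · simp only [octSum, Nat.add_assoc, Nat.reduceAdd, Nat.zero_add] at *; omega
    · have h2 := hG.nw_down (i + 1) j (by omega)
      simp only [octSum, Nat.add_assoc, Nat.reduceAdd] at *; omega
  · rw [flip_of_odd G (by omega), flip_of_even G (by omega), flip_of_even G (by omega),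
      flip_of_odd G (by omega)]
    have h1 := hG.nw_down i (j + 1) (by omega)
    rcases i with _ | i
    · simp only [octSum, Nat.add_assoc, Nat.reduceAdd, Nat.zero_add] at *; omega
    · have h2 := hG.nw_right i (j + 1) (by omega)
      simp only [octSum, Nat.add_assoc, Nat.reduceAdd] at *; omega

/-- The octahedron recurrence preserves the skep inequalities. -/
theorem SkepIneq.flip {n : ℕ} {G : ℕ → ℕ → ℤ} (hG : SkepIneq n G) :
    SkepIneq n (Skep.flip n G) where
  ne_right := hG.flip_ne_right
  ne_up i j h := by
    simpa only [flip_swap] using hG.swap.flip_ne_right j i (by omega)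
  nw_down := hG.flip_nw_down
  nw_right i j h := by
    have := hG.swap.flip_nw_down j i (by omega)
    simp only [flip_swap] at this
    omega
  corner h := by
    by_cases p : 0 % 2 = n % 2
    · rw [flip_of_even G (by omega), flip_of_even G (by omega)]
      exact hG.corner h
    · rw [flip_of_odd G (by omega), flip_of_odd G (by omega)]
      -- Here `n` is odd, so `n ≥ 3`; the two inequalities treat the two alternatives of `octSum` at
      -- `(1, 1)`.
      have h1 := hG.ne_right 0 0 (by omega)
      have h2 := hG.ne_up 0 0 (by omega)
      simp only [octSum, Nat.zero_add] at *; omega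

/-- Extension by zero of a function on `Δ_n` to the quadrant. -/
def extend {n : ℕ} (g : Delta n → ℤ) (i j : ℕ) : ℤ :=
  if h : i + j ≤ n then g (pt i j h) else 0

theorem extend_eq {n : ℕ} (g : Delta n → ℤ) {i j : ℕ} (h : i + j ≤ n) :
    extend g i j = g (pt i j h) := dif_pos h

theorem isSkep_iff {n : ℕ} (g : Delta n → ℤ) : IsSkep g ↔ SkepIneq n (extend g) := by
  constructor
  · intro hg
    constructor
    · intro i j h
      have := hg.ne_right i j h
      rw [extend_eq, extend_eq, extend_eq, extend_eq] <;> omega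
    · intro i j h
      have := hg.ne_up i j h
      rw [extend_eq, extend_eq, extend_eq, extend_eq] <;> omega
    · intro i j h
      have := hg.nw_down i j h
      rw [extend_eq, extend_eq, extend_eq, extend_eq] <;> omega
    · intro i j h
      have := hg.nw_right i j h
      rw [extend_eq, extend_eq, extend_eq, extend_eq] <;> omega
    · intro h
      have := hg.corner h
      rw [extend_eq, extend_eq] <;> omega
  · intro hG
    constructor
    · intro i j h
      have := hG.ne_right i j h
      rw [extend_eq, extend_eq, extend_eq, extend_eq] at this <;> omega
    · intro i j h
      have := hG.ne_up i j h
      rw [extend_eq, extend_eq, extend_eq, extend_eq] at this <;> omega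
    · intro i j h
      have := hG.nw_down i j h
      rw [extend_eq, extend_eq, extend_eq, extend_eq] at this <;> omega
    · intro i j h
      have := hG.nw_right i j h
      rw [extend_eq, extend_eq, extend_eq, extend_eq] at this <;> omega
    · intro h
      have := hG.corner h
      rw [extend_eq, extend_eq] at this <;> omega

/-! ### The involution on extensions -/

theorem interweave_even {n : ℕ} (gp : DeltaPlus n → ℤ) (gm : DeltaMinus n → ℤ) {i j : ℕ}
    (h : i + j ≤ n) (p : (i + j) % 2 = n % 2) :
    interweave gp gm (pt i j h) = gp ⟨(i, j), h, p⟩ := dif_pos p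

theorem interweave_odd {n : ℕ} (gp : DeltaPlus n → ℤ) (gm : DeltaMinus n → ℤ) {i j : ℕ}
    (h : i + j ≤ n) (p : (i + j + 1) % 2 = n % 2) :
    interweave gp gm (pt i j h) = gm ⟨(i, j), h, p⟩ := dif_neg (by simp only [pt]; omega)

/-- The map `g⁻ ↦ Φ(g⁻)` given by the octahedron recurrence. -/
def reflect {n : ℕ} (gp : DeltaPlus n → ℤ) (gm : DeltaMinus n → ℤ) : DeltaMinus n → ℤ :=
  fun p => octSum (extend (interweave gp gm)) p.1.1 p.1.2 - gm p

/-- Around a point of `Δ_n⁻`, `octSum` depends on `g⁺` only. -/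
theorem octSum_interweave {n : ℕ} (gp : DeltaPlus n → ℤ) (gm gm' : DeltaMinus n → ℤ) {i j : ℕ}
    (h : i + j ≤ n) (p : (i + j + 1) % 2 = n % 2) :
    octSum (extend (interweave gp gm)) i j = octSum (extend (interweave gp gm')) i j := by
  apply octSum_congr
  intro i' j' h'
  -- A point of `Δ_n⁻` has `i + j < n`, so its neighbours lie in `Δ_n⁺` and the default value of
  -- `extend` is never read.
  rw [extend_eq _ (by omega), extend_eq _ (by omega), interweave_even _ _ _ (by omega),
    interweave_even _ _ _ (by omega)]

theorem reflect_reflect {n : ℕ} (gp : DeltaPlus n → ℤ) (gm : DeltaMinus n → ℤ) :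
    reflect gp (reflect gp gm) = gm := by
  funext p
  have := octSum_interweave gp (reflect gp gm) gm p.2.1 p.2.2
  simp only [reflect] at this ⊢
  omega

theorem extend_interweave_reflect {n : ℕ} (gp : DeltaPlus n → ℤ) (gm : DeltaMinus n → ℤ)
    {i j : ℕ} (h : i + j ≤ n) :
    extend (interweave gp (reflect gp gm)) i j = flip n (extend (interweave gp gm)) i j := by
  by_cases p : (i + j) % 2 = n % 2
  · rw [flip_of_even _ p, extend_eq _ h, extend_eq _ h, interweave_even _ _ _ p,
      interweave_even _ _ _ p]
  · have p' : (i + j + 1) % 2 = n % 2 := by omega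
    rw [flip_of_odd _ p, extend_eq _ h, extend_eq _ h, interweave_odd _ _ _ p',
      interweave_odd _ _ _ p']
    rfl

theorem SkepIneq.congr {n : ℕ} {F G : ℕ → ℕ → ℤ} (hG : SkepIneq n G)
    (h : ∀ i j, i + j ≤ n → F i j = G i j) : SkepIneq n F where
  ne_right i j hn := by
    rw [h _ _ (by omega), h _ _ (by omega), h _ _ (by omega), h _ _ (by omega)]
    exact hG.ne_right i j hn
  ne_up i j hn := by
    rw [h _ _ (by omega), h _ _ (by omega), h _ _ (by omega), h _ _ (by omega)]
    exact hG.ne_up i j hn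
  nw_down i j hn := by
    rw [h _ _ (by omega), h _ _ (by omega), h _ _ (by omega), h _ _ (by omega)]
    exact hG.nw_down i j hn
  nw_right i j hn := by
    rw [h _ _ (by omega), h _ _ (by omega), h _ _ (by omega), h _ _ (by omega)]
    exact hG.nw_right i j hn
  corner hn := by
    rw [h _ _ (by omega), h _ _ (by omega)]
    exact hG.corner hn

theorem isSkep_reflect {n : ℕ} {gp : DeltaPlus n → ℤ} {gm : DeltaMinus n → ℤ}
    (h : IsSkep (interweave gp gm)) : IsSkep (interweave gp (reflect gp gm)) := by
  rw [isSkep_iff] at h ⊢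
  exact h.flip.congr fun i j hij => extend_interweave_reflect gp gm hij

/-! ### The boundary under the involution -/

/-- Along the corner path, `octSum` is the sum over the two adjacent points of the path. -/
theorem octSum_cornerPath {n : ℕ} (g : Delta n → ℤ) (k : ℕ) (hk : k + 2 ≤ 2 * n) :
    octSum (extend g) (n - (k + 1)) (k + 1 - n) =
      g (cornerPath k (by omega)) + g (cornerPath (k + 2) hk) := by
  have e : ∀ m (hm : m ≤ 2 * n), g (cornerPath m hm) = extend g (n - m) (m - n) :=
    fun m hm => (extend_eq g _).symm
  rw [e, e]
  -- The point of index `k + 1` is on the axis `j = 0`, at the origin, or on the axis `i = 0`: the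
  -- three boundary clauses of `octSum`.
  rcases lt_trichotomy (k + 1) n with h | h | h
  · obtain ⟨d, rfl⟩ := Nat.exists_eq_add_of_lt h
    rw [show k + 1 + d + 1 - (k + 1) = d + 1 by omega, show k + 1 - (k + 1 + d + 1) = 0 by omega,
      show k + 1 + d + 1 - k = d + 2 by omega, show k - (k + 1 + d + 1) = 0 by omega,
      show k + 1 + d + 1 - (k + 2) = d by omega, show k + 2 - (k + 1 + d + 1) = 0 by omega]
    exact add_comm _ _
  · subst h
    rw [show k + 1 - (k + 1) = 0 by omega, show k + 1 - k = 1 by omega,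
      show k - (k + 1) = 0 by omega, show k + 1 - (k + 2) = 0 by omega,
      show k + 2 - (k + 1) = 1 by omega]
    rfl
  · obtain ⟨d, rfl⟩ := Nat.exists_eq_add_of_le (Nat.lt_succ_iff.mp h)
    rw [show n + d + 1 - n = d + 1 by omega, show n - (n + d + 1) = 0 by omega,
      show n + d - n = d by omega, show n - (n + d) = 0 by omega,
      show n + d + 2 - n = d + 2 by omega, show n - (n + d + 2) = 0 by omega]
    rfl

/-- Replacing the middle of three consecutive values `a, x, b` by `a + b - x` swaps the differences
`x - a` and `b - x`. -/
theorem boundaryOne_reflect {n : ℕ} (gp : DeltaPlus n → ℤ) (gm : DeltaMinus n → ℤ) :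
    boundaryOne (interweave gp (reflect gp gm)) = boundaryTwo (interweave gp gm) := by
  funext k
  have hk := k.2
  have even : ∀ gm', interweave gp gm' (cornerPath (2 * k) (by omega)) =
      gp ⟨(n - 2 * k, 2 * k - n), by simp only; omega⟩ := fun gm' =>
    interweave_even gp gm' _ (by omega)
  have odd : ∀ gm', interweave gp gm' (cornerPath (2 * k + 1) (by omega)) =
      gm' ⟨(n - (2 * k + 1), 2 * k + 1 - n), by simp only; omega⟩ := fun gm' =>
    interweave_odd gp gm' _ (by omega)
  have key : octSum (extend (interweave gp gm)) (n - (2 * k + 1)) (2 * k + 1 - n) =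
      interweave gp gm (cornerPath (2 * k) (by omega)) +
        interweave gp gm (cornerPath (2 * k + 1 + 1) (by omega)) :=
    octSum_cornerPath (interweave gp gm) (2 * k) (by omega)
  rw [even] at key
  simp only [boundaryOne, boundaryTwo, cornerBoundary]
  rw [even, odd, odd]
  simp only [reflect]
  omega

theorem reflect_mem {n : ℕ} {gp : DeltaPlus n → ℤ} {lam mu : Fin n → ℤ}
    (hgp : outerBoundary gp = lam + mu) {gm : DeltaMinus n → ℤ}
    (h : gm ∈ skepExtensions gp lam) : reflect gp gm ∈ skepExtensions gp mu := by
  refine ⟨isSkep_reflect h.1, ?_⟩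
  rw [outerBoundary_eq gp gm, h.2] at hgp
  rw [boundaryOne_reflect]
  exact add_left_cancel hgp

theorem bijOn_reflect {n : ℕ} {gp : DeltaPlus n → ℤ} {lam mu : Fin n → ℤ}
    (hgp : outerBoundary gp = lam + mu) :
    Set.BijOn (reflect gp) (skepExtensions gp lam) (skepExtensions gp mu) :=
  Set.InvOn.bijOn
    ⟨fun gm _ => reflect_reflect gp gm, fun gm _ => reflect_reflect gp gm⟩
    (fun _ h => reflect_mem hgp h) (fun _ h => reflect_mem (hgp.trans (add_comm _ _)) h)

/-! ### Finiteness -/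

/-- The values of `(g⁺, g⁻)` on the axis `j = 0` are determined by `g⁺` and `∂₁(g⁺, g⁻)`. -/
theorem eq_on_axis {n : ℕ} {gp : DeltaPlus n → ℤ} {gm gm' : DeltaMinus n → ℤ}
    (h : boundaryOne (interweave gp gm) = boundaryOne (interweave gp gm')) {i : ℕ}
    (hi : i + 1 ≤ n) (p : (i + 1) % 2 = n % 2) :
    gm ⟨(i, 0), by omega, p⟩ = gm' ⟨(i, 0), by omega, p⟩ := by
  -- Chosen so that `(i, 0)` is the point of index `2 * k + 1` on the corner path.
  obtain ⟨k, rfl⟩ : ∃ k, n = i + 1 + 2 * k := ⟨(n - (i + 1)) / 2, by omega⟩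
  have hk := congrFun h ⟨k, by omega⟩
  have even : ∀ gm'', interweave gp gm'' (cornerPath (2 * k) (by omega)) =
      gp ⟨(i + 1 + 2 * k - 2 * k, 2 * k - (i + 1 + 2 * k)), by simp only; omega⟩ := fun gm'' =>
    interweave_even gp gm'' _ (by omega)
  have odd : ∀ gm'' : DeltaMinus (i + 1 + 2 * k) → ℤ,
      interweave gp gm'' (cornerPath (2 * k + 1) (by omega)) =
      gm'' ⟨(i, 0), by omega, p⟩ := fun gm'' => by
    rw [← interweave_odd gp gm'' (by omega) p]
    congr 1
    simp only [cornerPath, pt, Subtype.mk.injEq, Prod.mk.injEq]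
    omega
  simp only [boundaryOne, cornerBoundary] at hk
  rw [even, odd, even, odd] at hk
  omega

/-- The skep inequalities bound the differences of `g⁻` along antidiagonals in terms of `g⁺`; as
the values on the axis `j = 0` are fixed, all values of `g⁻` are bounded. -/
theorem exists_bound {n : ℕ} {gp : DeltaPlus n → ℤ} {gm : DeltaMinus n → ℤ} {lam : Fin n → ℤ}
    (hm : boundaryOne (interweave gp gm) = lam) (j : ℕ) :
    ∀ (i : ℕ) (h : i + j ≤ n) (p : (i + j + 1) % 2 = n % 2), ∃ a b : ℤ,
      ∀ gm' ∈ skepExtensions gp lam, gm' ⟨(i, j), h, p⟩ ∈ Set.Icc a b := by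
  induction j with
  | zero =>
    intro i h p
    refine ⟨gm ⟨(i, 0), h, p⟩, gm ⟨(i, 0), h, p⟩, fun gm' hgm' => ?_⟩
    rw [eq_on_axis (gm := gm') (gm' := gm) (hgm'.2.trans hm.symm) (by omega) p]
    exact Set.mem_Icc.2 ⟨le_rfl, le_rfl⟩
  | succ j ih =>
    intro i h p
    obtain ⟨a, b, hab⟩ := ih (i + 1) (by omega) (by omega)
    -- For the step from `(i + 1, j)` to `(i, j + 1)`, `nw_down` gives the lower bound and
    -- `nw_right` the upper one.
    refine ⟨a + gp ⟨(i, j + 2), by simp only; omega⟩ - gp ⟨(i + 1, j + 1), by simp only; omega⟩,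
      b + gp ⟨(i + 1, j + 1), by simp only; omega⟩ - gp ⟨(i + 2, j), by simp only; omega⟩,
      fun gm' hgm' => ?_⟩
    have h0 := hab gm' hgm'
    have h1 := hgm'.1.nw_down i j (by omega)
    have h2 := hgm'.1.nw_right i j (by omega)
    rw [interweave_even gp gm' _ (show (i + (j + 2)) % 2 = n % 2 by omega),
      interweave_even gp gm' _ (show (i + 1 + (j + 1)) % 2 = n % 2 by omega),
      interweave_odd gp gm' _ p,
      interweave_odd gp gm' _ (show (i + 1 + j + 1) % 2 = n % 2 by omega)] at h1
    rw [interweave_even gp gm' _ (show (i + 2 + j) % 2 = n % 2 by omega),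
      interweave_even gp gm' _ (show (i + 1 + (j + 1)) % 2 = n % 2 by omega),
      interweave_odd gp gm' _ p,
      interweave_odd gp gm' _ (show (i + 1 + j + 1) % 2 = n % 2 by omega)] at h2
    rw [Set.mem_Icc] at h0 ⊢
    omega

instance finite_deltaMinus (n : ℕ) : Finite (DeltaMinus n) :=
  Finite.of_injective
    (fun p : DeltaMinus n =>
      ((⟨p.1.1, by have := p.2.1; omega⟩, ⟨p.1.2, by have := p.2.1; omega⟩) :
        Fin (n + 1) × Fin (n + 1)))
    (fun p q h => by
      simp only [Prod.mk.injEq, Fin.mk.injEq] at h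
      exact Subtype.ext (Prod.ext h.1 h.2))

theorem finite_skepExtensions {n : ℕ} (gp : DeltaPlus n → ℤ) (lam : Fin n → ℤ) :
    (skepExtensions gp lam).Finite := by
  -- A member, if there is one, supplies the common values on the axis from which the bounds start.
  rcases (skepExtensions gp lam).eq_empty_or_nonempty with h | ⟨gm, hgm⟩
  · rw [h]; exact Set.finite_empty
  choose a b hab using fun p : DeltaMinus n =>
    exists_bound (gp := gp) hgm.2 p.1.2 p.1.1 p.2.1 p.2.2
  exact (Set.Finite.pi' fun p => Set.finite_Icc (a p) (b p)).subset
    fun gm' hgm' p => hab p gm' hgm'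

/-! ### Solutions of the octahedron recurrence -/

/-- Extension by zero of a function on `T_n`. -/
noncomputable def extendT {n : ℕ} (h : T n → ℤ) (t : ℤ) (i j : ℕ) : ℤ :=
  open Classical in if a : InT n i j t then h (tpt i j t a) else 0

theorem extendT_eq {n : ℕ} (h : T n → ℤ) {i j : ℕ} {t : ℤ} (a : InT n i j t) :
    extendT h t i j = h (tpt i j t a) := dif_pos a

theorem ObeysOctahedron.extendT {n : ℕ} {h : T n → ℤ} (hh : ObeysOctahedron h) {i j : ℕ} {t : ℤ}
    (a : InT n i j t) (b : InT n i j (t - 2)) :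
    extendT h t i j + extendT h (t - 2) i j = octSum (extendT h (t - 1)) i j := by
  rw [extendT_eq h a, extendT_eq h b]
  rcases i with _ | i <;> rcases j with _ | j <;> simp only [octSum]
  · rw [extendT_eq h (a.right b), extendT_eq h (a.up b)]
    exact hh.origin t a b
  · rw [extendT_eq h (a.down b), extendT_eq h (a.up b)]
    exact hh.left_edge j t a b
  · rw [extendT_eq h (a.left b), extendT_eq h (a.right b)]
    exact hh.bottom_edge i t a b
  · rw [extendT_eq h (a.left b), extendT_eq h (a.right b), extendT_eq h (a.down b),
      extendT_eq h (a.up b)]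
    exact hh.interior i j t a b

/-- The layers `t = k` of the solution with initial layers `t = 0` and `t = -1` both equal to `G`;
the layer `t = -1 - k` is the same. -/
def layer (G : ℕ → ℕ → ℤ) : ℕ → ℕ → ℕ → ℤ
  | 0 => G
  | 1 => fun i j => octSum G i j - G i j
  | k + 2 => fun i j => octSum (layer G (k + 1)) i j - layer G k i j

/-- The layer at height `t`. -/
def layerZ (G : ℕ → ℕ → ℤ) (t : ℤ) : ℕ → ℕ → ℤ :=
  layer G (if 0 ≤ t then t else -1 - t).toNat

/-- The recurrence is symmetric under `t ↦ -1 - t`, so the layers can be mirrored. -/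
theorem layerZ_add (G : ℕ → ℕ → ℤ) (t : ℤ) (i j : ℕ) :
    layerZ G t i j + layerZ G (t - 2) i j = octSum (layerZ G (t - 1)) i j := by
  have pos : ∀ k : ℕ, layerZ G k = layer G k := fun k => by
    rw [layerZ, if_pos (by omega), Int.toNat_natCast]
  have neg : ∀ k : ℕ, layerZ G (-1 - k) = layer G k := fun k => by
    rw [layerZ, if_neg (by omega)]; congr 1; omega
  have two : ∀ k : ℕ, layer G (k + 2) i j + layer G k i j = octSum (layer G (k + 1)) i j :=
    fun k => by simp only [layer]; omega
  rcases lt_or_ge t 0 with h | h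
  · obtain ⟨k, rfl⟩ : ∃ k : ℕ, t = -1 - k := ⟨(-1 - t).toNat, by omega⟩
    rw [neg, show (-1 - (k : ℤ) - 2) = -1 - (k + 2 : ℕ) by omega, neg,
      show (-1 - (k : ℤ) - 1) = -1 - (k + 1 : ℕ) by omega, neg, add_comm]
    exact two k
  · obtain ⟨k, rfl⟩ := Int.eq_ofNat_of_zero_le h
    -- For `t = 0` and `t = 1` the three heights straddle the mirror, and the claim is the
    -- definition of layer 1.
    match k with
    | 0 =>
      rw [pos, show ((0 : ℕ) : ℤ) - 2 = -1 - (1 : ℕ) by omega, neg,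
        show ((0 : ℕ) : ℤ) - 1 = -1 - (0 : ℕ) by omega, neg]
      simp only [layer]; omega
    | 1 =>
      rw [pos, show ((1 : ℕ) : ℤ) - 2 = -1 - (0 : ℕ) by omega, neg,
        show ((1 : ℕ) : ℤ) - 1 = (0 : ℕ) by omega, pos]
      simp only [layer]; omega
    | k + 2 =>
      rw [pos, show ((k + 2 : ℕ) : ℤ) - 2 = k by omega, pos,
        show ((k + 2 : ℕ) : ℤ) - 1 = (k + 1 : ℕ) by omega, pos]
      exact two k

/-- The solution of the octahedron recurrence with given bottom skep slice. -/
def octSolution {n : ℕ} (g : Delta n → ℤ) : T n → ℤ :=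
  fun p => layerZ (extend g) p.1.2.2 p.1.1 p.1.2.1

theorem octSolution_obeys {n : ℕ} (g : Delta n → ℤ) : ObeysOctahedron (octSolution g) where
  interior i j t _ _ := layerZ_add (extend g) t (i + 1) (j + 1)
  bottom_edge i t _ _ := layerZ_add (extend g) t (i + 1) 0
  left_edge j t _ _ := layerZ_add (extend g) t 0 (j + 1)
  origin t _ _ := layerZ_add (extend g) t 0 0

theorem skepBottom_octSolution {n : ℕ} (g : Delta n → ℤ) : skepBottom (octSolution g) = g := by
  funext p
  have h : layerZ (extend g) (-eps n p.1.1 p.1.2) = extend g := by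
    unfold eps
    split_ifs <;> rfl
  exact (congrFun (congrFun h p.1.1) p.1.2).trans (extend_eq g p.2)

/-- By parity, the points of `T n` at heights `0` and `-1` are exactly those of the bottom slice. -/
theorem extendT_bottom {n : ℕ} (h : T n → ℤ) {i j : ℕ} {t : ℤ} (a : InT n i j t)
    (ht : t = 0 ∨ t = -1) : extendT h t i j = extend (skepBottom h) i j := by
  have hij : i + j ≤ n := by
    simp only [InT, abs_le] at a; omega
  have e : t = -eps n i j := by
    simp only [InT, abs_le, Int.ModEq, eps] at a ⊢
    split_ifs <;> omega
  subst e
  rw [extend_eq _ hij, extendT_eq h a]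
  rfl

/-- A solution of the octahedron recurrence is determined by its bottom skep slice. -/
theorem ObeysOctahedron.extendT_eq_layerZ {n : ℕ} {h : T n → ℤ} (hh : ObeysOctahedron h) (k : ℕ) :
    ∀ (i j : ℕ) (t : ℤ), t = k ∨ t = -1 - k → InT n i j t →
      Skep.extendT h t i j = layerZ (extend (skepBottom h)) t i j := by
  induction k using Nat.strong_induction_on with
  | _ k ih =>
    intro i j t ht a
    rcases Nat.eq_zero_or_pos k with rfl | hk
    · rw [extendT_bottom h a (by omega)]
      rcases ht with rfl | rfl <;> rfl
    · have nbr : ∀ s : ℤ, InT n i j s → InT n i j (s - 2) →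
          (∀ i' j', InT n i' j' (s - 1) →
            Skep.extendT h (s - 1) i' j' = layerZ (extend (skepBottom h)) (s - 1) i' j') →
          octSum (Skep.extendT h (s - 1)) i j =
            octSum (layerZ (extend (skepBottom h)) (s - 1)) i j := by
        intro s hs hs' H
        apply octSum_congr
        intro i' j' hij
        apply H
        -- `|s|` and `|s - 2|` at most `n - i - j` force `|s - 1| ≤ n - i - j - 1`, so the
        -- neighbours are in `T n`.
        simp only [InT, abs_le, Int.ModEq] at hs hs' ⊢
        omega
      rcases ht with rfl | rfl
      · have b : InT n i j (k - 2) := by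
          simp only [InT, abs_le, Int.ModEq] at a ⊢; omega
        have e1 := hh.extendT a b
        have e2 := layerZ_add (extend (skepBottom h)) k i j
        have e3 := nbr k a b fun i' j' => ih (k - 1) (by omega) i' j' _ (by omega)
        have e4 : Skep.extendT h (k - 2) i j = layerZ (extend (skepBottom h)) (k - 2) i j := by
          -- For `k = 1` the height `k - 2 = -1` lies across the mirror and has index `0`.
          rcases Nat.lt_or_ge k 2 with h2 | h2
          · exact ih 0 hk i j _ (by omega) b
          · exact ih (k - 2) (by omega) i j _ (by omega) b
        omega
      · have a' : InT n i j ((-1 - k + 2 : ℤ) - 2) := by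
          rwa [show (-1 - k + 2 : ℤ) - 2 = -1 - k by omega]
        have b : InT n i j (-1 - k + 2) := by
          simp only [InT, abs_le, Int.ModEq] at a ⊢; omega
        have e1 := hh.extendT b a'
        have e2 := layerZ_add (extend (skepBottom h)) (-1 - k + 2) i j
        have e3 := nbr (-1 - k + 2) b a' fun i' j' => ih (k - 1) (by omega) i' j' _ (by omega)
        have e4 : Skep.extendT h (-1 - k + 2) i j =
            layerZ (extend (skepBottom h)) (-1 - k + 2) i j := by
          rcases Nat.lt_or_ge k 2 with h2 | h2
          · exact ih 0 hk i j _ (by omega) b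
          · exact ih (k - 2) (by omega) i j _ (by omega) b
        rw [show (-1 - k + 2 : ℤ) - 2 = -1 - k by omega] at e1 e2
        omega

theorem ObeysOctahedron.eq_octSolution {n : ℕ} {h : T n → ℤ} (hh : ObeysOctahedron h) :
    h = octSolution (skepBottom h) := by
  funext ⟨⟨i, j, t⟩, a⟩
  rw [octSolution, ← hh.extendT_eq_layerZ (if 0 ≤ t then t else -1 - t).toNat i j t
    (by split_ifs <;> omega) a, extendT_eq h a]
  rfl

/-- The top slice uses only heights `0` and `1`, so it is one `flip` away from the bottom slice. -/
theorem skepTop_octSolution {n : ℕ} (gp : DeltaPlus n → ℤ) (gm : DeltaMinus n → ℤ) :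
    skepTop (octSolution (interweave gp gm)) = interweave gp (reflect gp gm) := by
  funext ⟨⟨i, j⟩, hij⟩
  have e : layerZ (extend (interweave gp gm)) (eps n i j) i j =
      flip n (extend (interweave gp gm)) i j := by
    unfold eps flip
    split_ifs <;> rfl
  rw [← extend_interweave_reflect gp gm hij, extend_eq _ hij] at e
  exact e

end Skep

theorem mainTheorem7 (n : ℕ) (lam mu : Fin n → ℤ)
    (hlam : Skep.IsPartition lam) (hmu : Skep.IsPartition mu)
    (gp : Skep.DeltaPlus n → ℤ) (hgp : Skep.outerBoundary gp = lam + mu) :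
    (Skep.skepExtensions gp lam).Finite ∧ (Skep.skepExtensions gp mu).Finite ∧
    Skep.SkepExt gp lam = Skep.SkepExt gp mu ∧
    ∃ Φ : (Skep.DeltaMinus n → ℤ) → (Skep.DeltaMinus n → ℤ),
      Set.BijOn Φ (Skep.skepExtensions gp lam) (Skep.skepExtensions gp mu) ∧
      ∀ gm ∈ Skep.skepExtensions gp lam,
        (∃! h : Skep.T n → ℤ,
          Skep.ObeysOctahedron h ∧ Skep.skepBottom h = Skep.interweave gp gm) ∧
        ∀ h : Skep.T n → ℤ, Skep.ObeysOctahedron h →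
          Skep.skepBottom h = Skep.interweave gp gm →
          Skep.skepTop h = Skep.interweave gp (Φ gm) := by
  refine ⟨Skep.finite_skepExtensions gp lam, Skep.finite_skepExtensions gp mu,
    (Skep.bijOn_reflect hgp).ncard_eq, Skep.reflect gp, Skep.bijOn_reflect hgp,
    fun gm _ => ⟨⟨Skep.octSolution (Skep.interweave gp gm),
      ⟨Skep.octSolution_obeys _, Skep.skepBottom_octSolution _⟩, ?_⟩, ?_⟩⟩
  · rintro h ⟨hh, hb⟩
    rw [hh.eq_octSolution, hb]
  · intro h hh hb
    rw [hh.eq_octSolution, hb, Skep.skepTop_octSolution]
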